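/- Let $n,q\ge 1$. A random vector $X$ in $\mathbb{R}^n$ is elliptical with location $0$, positive definite scale matrix $\Sigma$, characteristic generator $\psi$ ($\psi(0)=1$) and density generator $g$ if its characteristic function is $t\mapsto\psi(t^{T}\Sigma t)$ and it has the Lebesgue density $x\mapsto \frac{c_n}{\sqrt{\det\Sigma}}\,g(x^{T}\Sigma^{-1}x)$, where $g\ge 0$ is measurable on $[0,\infty)$, $0<\int_0^\infty z^{n/2-1}g(z)\,dz<\infty$ and $c_n=\frac{\Gamma(n/2)}{\pi^{n/2}}\bigl(\int_0^\infty z^{n/2-1}g(z)\,dz\bigr)^{-1}$. For $\mu,\delta\in\mathbb{R}^n$, measurable $\alpha,\beta:\mathbb{R}^q\to[0,\infty)$ and a probability distribution $H$ on $\mathbb{R}^q$, write $Y\sim LSE_n(\mu,\Sigma,\delta,g,\alpha,\beta,H)$ if $Y\overset{d}{=}\mu+\alpha(Z)X+\beta(Z)\delta$, where $X$ is as above, $Z\sim H$, and $X$ and $Z$ are independent. A function $f:\mathbb{R}^n\to\mathbb{R}$ is componentwise convex if it is convex in each coordinate with the other coordinates fixed. Write $Y_1\le_{ccx}Y_2$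 if $E f(Y_1)\le E f(Y_2)$ for every componentwise convex $f$ for which both expectations exist (are finite). **Theorem.** Let $Y_1\sim LSE_n(\mu_1,\Sigma_1,\delta_1,g,\alpha,\beta,H)$ and $Y_2\sim LSE_n(\mu_2,\Sigma_2,\delta_2,g,\alpha,\beta,H)$, with $\Sigma_k=(\sigma_{k,ij})$ (and the same $\psi,g,\alpha,\beta,H$ for both). 1. If $\mu_1=\mu_2$, $\delta_1=\delta_2$, $\sigma_{1,ii}\le\sigma_{2,ii}$ for $1\le i\le n$ and $\sigma_{1,ij}=\sigma_{2,ij}$ for $1\le i<j\le n$, then $Y_1\le_{ccx}Y_2$. Suppose moreover that $Y_1$ and $Y_2$ have finite second moments and that $\alpha(Z)$ is not almost surely $0$. 2. If $\beta(Z)$ is not almost surely $0$ and $\mu_1=\mu_2$, then $Y_1\le_{ccx}Y_2$ if and only if $\delta_1=\delta_2$, $\sigma_{1,ii}\le\sigma_{2,ii}$ for $1\le i\le n$ and $\sigma_{1,ij}=\sigma_{2,ij}$ for $1\le i<j\le n$. 3. If $\delta_1=\delta_2$, then $Y_1\le_{ccx}Y_2$ if and only if $\mu_1=\mu_2$, $\sigma_{1,ii}\le\sigma_{2,ii}$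 for $1\le i\le n$ and $\sigma_{1,ij}=\sigma_{2,ij}$ for $1\le i<j\le n$. -/

import Mathlib

open MeasureTheory ProbabilityTheory Set
open scoped Matrix

noncomputable section

/-- The quadratic form `tᵀ S t`. -/
def quadForm {n : ℕ} (S : Matrix (Fin n) (Fin n) ℝ) (t : EuclideanSpace ℝ (Fin n)) : ℝ :=
  t.ofLp ⬝ᵥ (S *ᵥ t.ofLp)

/-- `Q` is an elliptical distribution with location `μ`, scale matrix `S` and characteristic
generator `ψ`: its characteristic function is `t ↦ exp (i tᵀ μ) ψ (tᵀ S t)`, with `ψ 0 = 1`. -/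
structure IsElliptical {n : ℕ} (Q : Measure (EuclideanSpace ℝ (Fin n)))
    (μ : EuclideanSpace ℝ (Fin n)) (S : Matrix (Fin n) (Fin n) ℝ) (ψ : ℝ → ℝ) : Prop where
  isProbabilityMeasure : IsProbabilityMeasure Q
  generator_zero : ψ 0 = 1
  charFun_eq : ∀ t : EuclideanSpace ℝ (Fin n),
    charFun Q t = Complex.exp (Complex.I * ((inner ℝ t μ : ℝ) : ℂ)) * ((ψ (quadForm S t) : ℝ) : ℂ)

/-- `g` is an admissible density generator in dimension `n`: nonnegative on `[0, ∞)` and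
`0 < ∫₀^∞ z ^ (n / 2 - 1) g(z) dz < ∞`. -/
structure IsDensityGenerator (n : ℕ) (g : ℝ → ℝ) : Prop where
  measurable : Measurable g
  nonneg : ∀ u, 0 ≤ u → 0 ≤ g u
  integrableOn : IntegrableOn (fun z : ℝ => z ^ ((n : ℝ) / 2 - 1) * g z) (Ioi 0)
  integral_pos : 0 < ∫ z in Ioi (0 : ℝ), z ^ ((n : ℝ) / 2 - 1) * g z

/-- The normalizing constant `c_n = Γ(n/2) / π^(n/2) * (∫₀^∞ z^(n/2-1) g(z) dz)⁻¹`. -/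
def normalizingConst (n : ℕ) (g : ℝ → ℝ) : ℝ :=
  Real.Gamma ((n : ℝ) / 2) / Real.pi ^ ((n : ℝ) / 2) *
    (∫ z in Ioi (0 : ℝ), z ^ ((n : ℝ) / 2 - 1) * g z)⁻¹

/-- `Q` has the elliptical Lebesgue density
`x ↦ c_n / √(det S) * g ((x - μ)ᵀ S⁻¹ (x - μ))`. -/
def HasEllipticalDensity {n : ℕ} (Q : Measure (EuclideanSpace ℝ (Fin n)))
    (μ : EuclideanSpace ℝ (Fin n)) (S : Matrix (Fin n) (Fin n) ℝ) (g : ℝ → ℝ) : Prop :=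
  Q = volume.withDensity fun x =>
    ENNReal.ofReal (normalizingConst n g / Real.sqrt S.det * g (quadForm S⁻¹ (x - μ)))

/-- The random vector `Y` has the location-scale mixture of elliptical distributions
`LSE_n(μ, S, δ, ψ, g, α, β, H)`: it is distributed as `μ + α(Z) X + β(Z) δ`, where `X` is
elliptical with location `0`, positive definite scale matrix `S`, characteristic generator `ψ` and
density generator `g`, where `Z` has distribution `H`, and where `X` and `Z` are independent
(that is, `(X, Z)` has law `Q.prod H`, with `Q` the law of `X`). -/
def IsLSE {n q : ℕ} {Ω : Type*} [MeasurableSpace Ω] (P : Measure Ω)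
    (Y : Ω → EuclideanSpace ℝ (Fin n))
    (μ : EuclideanSpace ℝ (Fin n)) (S : Matrix (Fin n) (Fin n) ℝ) (δ : EuclideanSpace ℝ (Fin n))
    (ψ g : ℝ → ℝ) (α β : EuclideanSpace ℝ (Fin q) → ℝ)
    (H : Measure (EuclideanSpace ℝ (Fin q))) : Prop :=
  S.PosDef ∧ IsDensityGenerator n g ∧
    ∃ Q : Measure (EuclideanSpace ℝ (Fin n)),
      IsElliptical Q 0 S ψ ∧ HasEllipticalDensity Q 0 S g ∧
      HasLaw Y ((Q.prod H).map fun p => μ + α p.2 • p.1 + β p.2 • δ) P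

/-- `f` is convex in each coordinate when the other coordinates are held fixed. -/
def ComponentwiseConvex {n : ℕ} (f : EuclideanSpace ℝ (Fin n) → ℝ) : Prop :=
  ∀ (x : EuclideanSpace ℝ (Fin n)) (i : Fin n),
    ConvexOn ℝ univ fun s : ℝ => f (x + EuclideanSpace.single i s)

/-- The componentwise convex order `Y₁ ≤_ccx Y₂`: `E f(Y₁) ≤ E f(Y₂)` for all componentwise convex
`f` for which both expectations exist. -/
def CcxLE {n : ℕ} {Ω₁ Ω₂ : Type*} [MeasurableSpace Ω₁] [MeasurableSpace Ω₂]
    (P₁ : Measure Ω₁) (P₂ : Measure Ω₂)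
    (Y₁ : Ω₁ → EuclideanSpace ℝ (Fin n)) (Y₂ : Ω₂ → EuclideanSpace ℝ (Fin n)) : Prop :=
  ∀ f : EuclideanSpace ℝ (Fin n) → ℝ, ComponentwiseConvex f →
    Integrable (fun ω => f (Y₁ ω)) P₁ → Integrable (fun ω => f (Y₂ ω)) P₂ →
    ∫ ω, f (Y₁ ω) ∂P₁ ≤ ∫ ω, f (Y₂ ω) ∂P₂

end

/-! Sufficiency: it is enough to raise one diagonal entry of the scale matrix, say the `i`-th. Let
`r(x)` be the residual of `x i` after linear regression on the other coordinates. Flipping the sign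
of `r` along direction `i` preserves the elliptical law, and multiplying `r` by a suitable `u ≥ 1`
yields the law with the same generator and the larger entry. On each line in direction `i`, a convex
function has a larger average over the more widely spread symmetric pair, so averaging over the flip
gives the inequality (`IsElliptical.exists_stretch`). Iterating over `i` compares the laws of `X`;
conditioning on `Z` passes to mixtures, and truncation passes from nonnegative to integrable test
functions.

Necessity: the test functions `± x i`, `± x i * x j` with `i ≠ j`, and `x i * x i` compare first and
second moments. Second moments of `X` are the entries of the scale matrix times a constant depending
only on `ψ`. This constant is positive because `X` has a density. -/

/-! ### Measurability and stability of componentwise convex functions. -/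

/-- Induction on the dimension: with the first coordinate split off, `f` is continuous in it and, by
induction, measurable in the others, hence jointly measurable as a Carathéodory function. -/
theorem measurable_of_continuous_update : ∀ {n : ℕ} (f : (Fin n → ℝ) → ℝ),
    (∀ x i, Continuous fun s : ℝ => f (Function.update x i s)) → Measurable f
  | 0, _, _ => Measurable.of_discrete
  | n + 1, f, hf => by
    have hcont : ∀ y : Fin n → ℝ, Continuous fun s : ℝ => f (Fin.cons s y) := by
      intro y
      simpa using hf (Fin.cons 0 y) 0
    have hmeas : ∀ s : ℝ, Measurable fun y : Fin n → ℝ => f (Fin.cons s y) := by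
      intro s
      refine measurable_of_continuous_update _ fun y i => ?_
      simpa using hf (Fin.cons s y) i.succ
    have h := measurable_uncurry_of_continuous_of_measurable
      (u := fun (s : ℝ) (y : Fin n → ℝ) => f (Fin.cons s y)) hcont hmeas
    have hm : Measurable fun x : Fin (n + 1) → ℝ => (x 0, Fin.tail x) :=
      (measurable_pi_apply 0).prodMk (measurable_pi_lambda _ fun i => measurable_pi_apply i.succ)
    have he : f = (Function.uncurry fun (s : ℝ) (y : Fin n → ℝ) => f (Fin.cons s y)) ∘
        fun x : Fin (n + 1) → ℝ => (x 0, Fin.tail x) := by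
      ext x
      simp [Function.uncurry, Fin.cons_self_tail]
    rw [he]
    exact h.comp hm

namespace ComponentwiseConvex

variable {n : ℕ} {f : EuclideanSpace ℝ (Fin n) → ℝ}

theorem measurable (hf : ComponentwiseConvex f) : Measurable f := by
  have h : Measurable fun x : Fin n → ℝ => f (WithLp.toLp 2 x) := by
    refine measurable_of_continuous_update _ fun x i => ?_
    have hc : Continuous fun s : ℝ => f (WithLp.toLp 2 x + EuclideanSpace.single i s) := by
      rw [← continuousOn_univ]
      exact (hf (WithLp.toLp 2 x) i).continuousOn isOpen_univ
    have he : (fun s : ℝ => f (WithLp.toLp 2 (Function.update x i s))) =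
        fun s => f (WithLp.toLp 2 x + EuclideanSpace.single i (s - x i)) := by
      ext s
      congr 1
      ext j
      by_cases hj : j = i
      · subst hj
        simp
      · simp [hj]
    rw [he]
    exact hc.comp (continuous_id.sub continuous_const)
  exact h.comp (WithLp.measurable_ofLp 2 (Fin n → ℝ))

theorem comp_add_smul (hf : ComponentwiseConvex f) (b : EuclideanSpace ℝ (Fin n)) (a : ℝ) :
    ComponentwiseConvex fun x => f (b + a • x) := by
  intro x i
  refine ((hf (b + a • x) i).comp_linearMap (LinearMap.lsmul ℝ ℝ a)).congr fun s _ => ?_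
  simp only [Function.comp, LinearMap.lsmul_apply, smul_add, add_assoc]
  congr 3
  ext j
  by_cases hj : j = i
  · subst hj
    simp
  · simp [hj]

theorem max_const (hf : ComponentwiseConvex f) (c : ℝ) :
    ComponentwiseConvex fun x => max (f x) c :=
  fun x i => (hf x i).sup (convexOn_const c convex_univ)

theorem add_const (hf : ComponentwiseConvex f) (c : ℝ) :
    ComponentwiseConvex fun x => f x + c :=
  fun x i => (hf x i).add (convexOn_const c convex_univ)

end ComponentwiseConvex

/-- The inner points `m ± r` are convex combinations of `m ± s` with weights `(s + r) / (2 * s)` and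
`(s - r) / (2 * s)`, in the two orders; the two convexity inequalities add up. -/
theorem ConvexOn.add_le_add_of_symmetric {φ : ℝ → ℝ} (hφ : ConvexOn ℝ univ φ) (m r s : ℝ)
    (hr : 0 ≤ r) (hs : r ≤ s) : φ (m + r) + φ (m - r) ≤ φ (m + s) + φ (m - s) := by
  rcases hs.eq_or_lt with rfl | hlt
  · exact le_rfl
  have hs0 : 0 < s := hr.trans_lt hlt
  have h2 : 0 < 2 * s := by linarith
  have hsum : (s + r) / (2 * s) + (s - r) / (2 * s) = 1 := by
    field_simp
    ring
  have h₁ := hφ.2 (mem_univ (m + s)) (mem_univ (m - s))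
    (div_nonneg (by linarith) h2.le) (div_nonneg (by linarith) h2.le) hsum
  have h₃ := hφ.2 (mem_univ (m - s)) (mem_univ (m + s))
    (div_nonneg (by linarith) h2.le) (div_nonneg (by linarith) h2.le) hsum
  have e₁ : ((s + r) / (2 * s)) • (m + s) + ((s - r) / (2 * s)) • (m - s) = m + r := by
    simp only [smul_eq_mul]
    field_simp
    ring
  have e₃ : ((s + r) / (2 * s)) • (m - s) + ((s - r) / (2 * s)) • (m + s) = m - r := by
    simp only [smul_eq_mul]
    field_simp
    ring
  rw [e₁] at h₁
  rw [e₃] at h₃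
  simp only [smul_eq_mul] at h₁ h₃
  calc φ (m + r) + φ (m - r)
      ≤ ((s + r) / (2 * s) + (s - r) / (2 * s)) * (φ (m + s) + φ (m - s)) := by linarith
    _ = φ (m + s) + φ (m - s) := by rw [hsum, one_mul]

/-! ### Elliptical laws: linear images and growth of the diagonal. -/

theorem charFun_map_of_inner_eq {E F : Type*} [MeasurableSpace E] [MeasurableSpace F]
    [NormedAddCommGroup E] [InnerProductSpace ℝ E] [NormedAddCommGroup F] [InnerProductSpace ℝ F]
    [BorelSpace F] [SecondCountableTopology F]
    (Q : Measure E) {L : E → F} (hL : Measurable L) {t : F} {t' : E}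
    (h : ∀ x, inner ℝ (L x) t = inner ℝ x t') : charFun (Q.map L) t = charFun Q t' := by
  rw [charFun_apply, charFun_apply, integral_map hL.aemeasurable]
  · simp_rw [h]
  · exact (by fun_prop : Continuous fun x : F =>
      Complex.exp (((inner ℝ x t : ℝ) : ℂ) * Complex.I)).aestronglyMeasurable

section Elliptical

variable {n : ℕ} {Q : Measure (EuclideanSpace ℝ (Fin n))} {S S' : Matrix (Fin n) (Fin n) ℝ}
  {ψ : ℝ → ℝ}

theorem IsElliptical.charFun_eq_of_zero (h : IsElliptical Q 0 S ψ)
    (t : EuclideanSpace ℝ (Fin n)) : charFun Q t = ((ψ (quadForm S t) : ℝ) : ℂ) := by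
  simp [h.charFun_eq t]

theorem IsElliptical.map_zero (h : IsElliptical Q 0 S ψ)
    {L A : EuclideanSpace ℝ (Fin n) → EuclideanSpace ℝ (Fin n)} (hL : Measurable L)
    (hA : ∀ x t, inner ℝ (L x) t = inner ℝ x (A t))
    (hS : ∀ t, quadForm S' t = quadForm S (A t)) : IsElliptical (Q.map L) 0 S' ψ where
  isProbabilityMeasure :=
    have := h.isProbabilityMeasure
    Measure.isProbabilityMeasure_map hL.aemeasurable
  generator_zero := h.generator_zero
  charFun_eq t := by
    rw [charFun_map_of_inner_eq Q hL (fun x => hA x t), h.charFun_eq_of_zero, hS]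
    simp

theorem IsElliptical.unique {Q' : Measure (EuclideanSpace ℝ (Fin n))}
    (h : IsElliptical Q 0 S ψ) (h' : IsElliptical Q' 0 S' ψ)
    (hS : ∀ t, quadForm S t = quadForm S' t) : Q = Q' := by
  have := h.isProbabilityMeasure
  have := h'.isProbabilityMeasure
  refine Measure.ext_of_charFun (funext fun t => ?_)
  rw [h.charFun_eq_of_zero, h'.charFun_eq_of_zero, hS]

theorem quadForm_add_smul (hS : Sᵀ = S) (t w : EuclideanSpace ℝ (Fin n)) (c : ℝ) :
    quadForm S (t + c • w) =
      quadForm S t + 2 * c * (t.ofLp ⬝ᵥ (S *ᵥ w.ofLp)) + c ^ 2 * quadForm S w := by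
  have hsymm : w.ofLp ⬝ᵥ (S *ᵥ t.ofLp) = t.ofLp ⬝ᵥ (S *ᵥ w.ofLp) := by
    rw [Matrix.dotProduct_mulVec, ← Matrix.mulVec_transpose, hS, dotProduct_comm]
  simp only [quadForm, WithLp.ofLp_add, WithLp.ofLp_smul, Matrix.mulVec_add, Matrix.mulVec_smul,
    add_dotProduct, dotProduct_add, smul_dotProduct, dotProduct_smul, smul_eq_mul, hsymm]
  ring

/-- Stretching an elliptical law along its residual in direction `i` increases the `i`-th diagonal
entry of the scale matrix and the expectations of nonnegative componentwise convex functions. -/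
theorem IsElliptical.exists_stretch (h : IsElliptical Q 0 S ψ) (hS : Sᵀ = S) (i : Fin n)
    {w : EuclideanSpace ℝ (Fin n)} (hw : S *ᵥ w.ofLp = Pi.single i 1) (hwi : 0 < w i)
    {d : ℝ} (hd : 0 ≤ d) (hS' : ∀ t, quadForm S' t = quadForm S t + d * t i ^ 2) :
    ∃ Q', IsElliptical Q' 0 S' ψ ∧ ∀ f, ComponentwiseConvex f → (∀ x, 0 ≤ f x) →
      ∫⁻ x, ENNReal.ofReal (f x) ∂Q ≤ ∫⁻ x, ENNReal.ofReal (f x) ∂Q' := by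
  set τ := w i with hτ
  -- Since `w` is the `i`-th column of the inverse of `S`, `r` is the regression residual: a shift
  -- by `s` in coordinate `i` shifts it by `s`. `L k` multiplies it by `1 + k`, and `A k` is the
  -- adjoint of `L k`.
  let r : EuclideanSpace ℝ (Fin n) → ℝ := fun x => inner ℝ x w / τ
  let L : ℝ → EuclideanSpace ℝ (Fin n) → EuclideanSpace ℝ (Fin n) :=
    fun k x => x + EuclideanSpace.single i (k * r x)
  let A : ℝ → EuclideanSpace ℝ (Fin n) → EuclideanSpace ℝ (Fin n) :=
    fun k t => t + (k * t i / τ) • w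
  have hLm : ∀ k, Measurable (L k) := by
    intro k
    have : Continuous fun x => (WithLp.toLp 2 (Pi.single i (k * r x)) : EuclideanSpace ℝ (Fin n)) := by
      refine (PiLp.continuous_toLp 2 _).comp ((continuous_single i).comp ?_)
      simp only [r]
      fun_prop
    exact (continuous_id.add this).measurable
  have hLA : ∀ k x t, inner ℝ (L k x) t = inner ℝ x (A k t) := by
    intro k x t
    simp only [L, A, r, inner_add_left, inner_add_right, inner_smul_right,
      EuclideanSpace.inner_single_left]
    simp
    ring
  have hquad : ∀ k t, quadForm S (A k t) = quadForm S t + (k ^ 2 + 2 * k) / τ * t i ^ 2 := by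
    intro k t
    have hww : quadForm S w = τ := by simp [quadForm, hw, hτ]
    simp only [A]
    rw [quadForm_add_smul hS, hw, hww]
    simp only [dotProduct_single, mul_one]
    field_simp
    ring
  -- The reflection `r ↦ -r` is `k = -2`, the nonzero root of `k ^ 2 + 2 * k`.
  have hB : Q.map (L (-2)) = Q :=
    (h.map_zero (hLm _) (hLA _) (S' := S) fun t => by rw [hquad]; ring).unique h fun _ => rfl
  have hrs : ∀ x s, r (x + EuclideanSpace.single i s) = r x + s := by
    intro x s
    simp only [r, inner_add_left, EuclideanSpace.inner_single_left]
    simp only [conj_trivial, ← hτ]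
    field_simp
  -- The factor is forced by `k = u - 1`: the added coefficient `(u ^ 2 - 1) / τ` must equal `d`.
  set u := Real.sqrt (1 + d * τ) with hu
  have hu2 : u ^ 2 = 1 + d * τ := Real.sq_sqrt (by positivity)
  have hu1 : 1 ≤ u := by
    rw [hu, Real.one_le_sqrt]
    nlinarith [mul_nonneg hd hwi.le]
  refine ⟨Q.map (L (u - 1)), h.map_zero (hLm _) (hLA _) fun t => ?_, fun f hf hf0 => ?_⟩
  · rw [hquad, hS']
    have : (u - 1) ^ 2 + 2 * (u - 1) = d * τ := by linear_combination hu2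
    rw [this]
    field_simp
  -- Invariance under the reflection allows each integrand to be averaged over the pair `x`, `L (-2)
  -- x`.
  have hsym : ∀ F : EuclideanSpace ℝ (Fin n) → ℝ, Measurable F → (∀ x, 0 ≤ F x) →
      2 * ∫⁻ x, ENNReal.ofReal (F x) ∂Q = ∫⁻ x, ENNReal.ofReal (F x + F (L (-2) x)) ∂Q := by
    intro F hF hF0
    have h1 : ∫⁻ x, ENNReal.ofReal (F (L (-2) x)) ∂Q = ∫⁻ x, ENNReal.ofReal (F x) ∂Q := by
      conv_rhs => rw [← hB]
      rw [lintegral_map hF.ennreal_ofReal (hLm _)]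
    simp_rw [ENNReal.ofReal_add (hF0 _) (hF0 _)]
    rw [lintegral_add_left hF.ennreal_ofReal, h1, two_mul]
  rw [lintegral_map hf.measurable.ennreal_ofReal (hLm _)]
  have hle : 2 * ∫⁻ x, ENNReal.ofReal (f x) ∂Q ≤
      2 * ∫⁻ x, ENNReal.ofReal (f (L (u - 1) x)) ∂Q := by
    rw [hsym f hf.measurable hf0, hsym (fun x => f (L (u - 1) x)) (hf.measurable.comp (hLm _))
      fun x => hf0 _]
    refine lintegral_mono fun x => ENNReal.ofReal_le_ofReal ?_
    have hφ := hf x i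
    have e0 : L (-2) x = x + EuclideanSpace.single i (-r x - r x) := by
      simp only [L]
      congr 2
      ring
    have e1 : L (u - 1) x = x + EuclideanSpace.single i (-r x + u * r x) := by
      simp only [L]
      congr 2
      ring
    have e2 : L (u - 1) (L (-2) x) = x + EuclideanSpace.single i (-r x - u * r x) := by
      rw [e0]
      simp only [L, hrs, add_assoc]
      congr 1
      ext j
      by_cases hj : j = i
      · subst hj
        simp
        ring
      · simp [hj]
    -- On the line through `x` in direction `i`, the residual vanishes at parameter `-r x`, the
    -- common midpoint of the pairs before and after stretching.
    have e3 : x = x + EuclideanSpace.single i (-r x + r x) := by simp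
    rw [e2, e1, e0]
    nth_rewrite 1 [e3]
    rcases le_total 0 (r x) with hr | hr
    · exact hφ.add_le_add_of_symmetric (-r x) (r x) (u * r x) hr (le_mul_of_one_le_left hr hu1)
    · have := hφ.add_le_add_of_symmetric (-r x) (-r x) (-(u * r x)) (by linarith)
        (by nlinarith)
      simp only [← sub_eq_add_neg, sub_neg_eq_add] at this
      simpa only [add_comm, sub_eq_add_neg] using this
  exact (ENNReal.mul_le_mul_iff_right (by simp) (by simp)).1 hle

theorem IsElliptical.lintegral_le (h : IsElliptical Q 0 S ψ) (hS : S.PosDef)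
    {Q' : Measure (EuclideanSpace ℝ (Fin n))} (h' : IsElliptical Q' 0 S' ψ) (hS' : S'.PosDef)
    (hdiag : ∀ i, S i i ≤ S' i i) (hoff : ∀ i j, i < j → S i j = S' i j)
    {f : EuclideanSpace ℝ (Fin n) → ℝ} (hf : ComponentwiseConvex f) (hf0 : ∀ x, 0 ≤ f x) :
    ∫⁻ x, ENNReal.ofReal (f x) ∂Q ≤ ∫⁻ x, ENNReal.ofReal (f x) ∂Q' := by
  classical
  -- The coordinates in `s` already carry the diagonal entries of `S'`; the increments are
  -- nonnegative, so positive definiteness persists.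
  let D : Finset (Fin n) → Matrix (Fin n) (Fin n) ℝ :=
    fun s => S + Matrix.diagonal fun i => if i ∈ s then S' i i - S i i else 0
  have hD : ∀ s, (D s).PosDef := fun s => hS.add_posSemidef <| Matrix.PosSemidef.diagonal fun i => by
    by_cases hi : i ∈ s
    · simpa [hi] using hdiag i
    · simp [hi]
  have key : ∀ s : Finset (Fin n), ∃ Q₀, IsElliptical Q₀ 0 (D s) ψ ∧
      ∫⁻ x, ENNReal.ofReal (f x) ∂Q ≤ ∫⁻ x, ENNReal.ofReal (f x) ∂Q₀ := by
    intro s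
    induction s using Finset.induction_on with
    | empty => exact ⟨Q, by simpa [D] using h, le_rfl⟩
    | insert i s hi ih =>
      obtain ⟨Q₀, hQ₀, hle⟩ := ih
      have hunit : IsUnit (D s).det := (Matrix.isUnit_iff_isUnit_det _).1 (hD s).isUnit
      have hw : D s *ᵥ ((D s)⁻¹ *ᵥ Pi.single i 1) = Pi.single i 1 := by
        rw [Matrix.mulVec_mulVec, Matrix.mul_nonsing_inv _ hunit, Matrix.one_mulVec]
      have hwi : 0 < ((D s)⁻¹ *ᵥ Pi.single i 1) i := by
        have := (hD s).inv.dotProduct_mulVec_pos (x := Pi.single i 1) (by simp)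
        simpa using this
      obtain ⟨Q₁, hQ₁, hle₁⟩ := hQ₀.exists_stretch (S' := D (insert i s))
        (by simpa using (hD s).isHermitian.eq) i
        (w := WithLp.toLp 2 ((D s)⁻¹ *ᵥ Pi.single i 1)) hw hwi
        (sub_nonneg.2 (hdiag i)) (fun t => by
          have : D (insert i s) = D s + Matrix.diagonal (Pi.single i (S' i i - S i i)) := by
            simp only [D, add_assoc, Matrix.diagonal_add]
            congr 2
            ext j
            by_cases hj : j = i
            · subst hj
              simp [hi]
            · simp [hj]
          rw [this]
          simp only [quadForm, Matrix.add_mulVec, dotProduct_add, add_right_inj]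
          rw [dotProduct, Finset.sum_eq_single i]
          · simp [Matrix.mulVec_diagonal]
            ring
          · intro j _ hj
            simp [Matrix.mulVec_diagonal, hj]
          · simp)
      exact ⟨Q₁, hQ₁, hle.trans (hle₁ f hf hf0)⟩
  obtain ⟨Q₀, hQ₀, hle⟩ := key Finset.univ
  have hDS : D Finset.univ = S' := by
    have hSs : ∀ i j, S i j = S j i := fun i j => by simpa using (hS.isHermitian.apply i j).symm
    have hSs' : ∀ i j, S' i j = S' j i := fun i j => by simpa using (hS'.isHermitian.apply i j).symm
    ext i j
    rcases lt_trichotomy i j with hij | rfl | hij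
    · simp [D, hij.ne, hoff i j hij]
    · simp [D]
    · simp [D, hij.ne', hSs i j, hSs' i j, hoff j i hij]
  -- The generator is unchanged throughout, so the last law constructed is `Q'` itself.
  rwa [hQ₀.unique h' fun t => by rw [hDS]] at hle

end Elliptical

/-- Truncating below at `-N` and adding `N` keeps componentwise convexity and gives a nonnegative
function; dominated convergence removes the truncation. -/
theorem integral_le_of_lintegral_ccx_le {n : ℕ} {m₁ m₂ : Measure (EuclideanSpace ℝ (Fin n))}
    [IsProbabilityMeasure m₁] [IsProbabilityMeasure m₂]
    (h : ∀ f, ComponentwiseConvex f → (∀ x, 0 ≤ f x) →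
      ∫⁻ x, ENNReal.ofReal (f x) ∂m₁ ≤ ∫⁻ x, ENNReal.ofReal (f x) ∂m₂)
    {f : EuclideanSpace ℝ (Fin n) → ℝ} (hf : ComponentwiseConvex f)
    (h₁ : Integrable f m₁) (h₂ : Integrable f m₂) : ∫ x, f x ∂m₁ ≤ ∫ x, f x ∂m₂ := by
  have htrunc : ∀ N : ℕ, ∫ x, max (f x) (-N) ∂m₁ ≤ ∫ x, max (f x) (-N) ∂m₂ := by
    intro N
    have i₁ : Integrable (fun x => max (f x) (-(N : ℝ))) m₁ := h₁.sup (integrable_const _)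
    have i₂ : Integrable (fun x => max (f x) (-(N : ℝ))) m₂ := h₂.sup (integrable_const _)
    have hF : ∀ x, 0 ≤ max (f x) (-(N : ℝ)) + N := fun x => by
      linarith [le_max_right (f x) (-(N : ℝ))]
    have hle := h _ ((hf.max_const (-(N : ℝ))).add_const N) hF
    have j₁ := i₁.add (integrable_const (N : ℝ))
    have j₂ := i₂.add (integrable_const (N : ℝ))
    have hle' : ∫ x, (max (f x) (-(N : ℝ)) + N) ∂m₁ ≤ ∫ x, (max (f x) (-(N : ℝ)) + N) ∂m₂ := by
      rw [integral_eq_lintegral_of_nonneg_ae (ae_of_all _ hF) j₁.aestronglyMeasurable,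
        integral_eq_lintegral_of_nonneg_ae (ae_of_all _ hF) j₂.aestronglyMeasurable]
      exact ENNReal.toReal_mono j₂.lintegral_lt_top.ne hle
    rw [integral_add i₁ (integrable_const _), integral_add i₂ (integrable_const _)] at hle'
    simpa using hle'
  have hlim : ∀ m : Measure (EuclideanSpace ℝ (Fin n)), Integrable f m →
      Filter.Tendsto (fun N : ℕ => ∫ x, max (f x) (-(N : ℝ)) ∂m) Filter.atTop
        (nhds (∫ x, f x ∂m)) := by
    intro m hm
    refine tendsto_integral_of_dominated_convergence (fun x => |f x|)
      (fun N => (hf.max_const _).measurable.aestronglyMeasurable) hm.abs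
      (fun N => ae_of_all _ fun x => ?_) (ae_of_all _ fun x => ?_)
    · have hN : (0 : ℝ) ≤ N := N.cast_nonneg
      rw [Real.norm_eq_abs, abs_le]
      exact ⟨(neg_abs_le _).trans (le_max_left _ _),
        max_le (le_abs_self _) (by linarith [abs_nonneg (f x)])⟩
    · obtain ⟨M, hM⟩ := exists_nat_ge (-f x)
      refine tendsto_const_nhds.congr' ?_
      filter_upwards [Filter.eventually_ge_atTop M] with N hN
      have : (M : ℝ) ≤ N := by exact_mod_cast hN
      rw [max_eq_left]
      linarith
  exact le_of_tendsto_of_tendsto' (hlim m₁ h₁) (hlim m₂ h₂) htrunc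

/-! ### Mixtures: conditioning on the mixing variable, and moments. -/

section LSE

variable {n q : ℕ}

/-- The representation `μ + α(z) x + β(z) δ` of a location-scale mixture. -/
def lseMap (μ δ : EuclideanSpace ℝ (Fin n)) (α β : EuclideanSpace ℝ (Fin q) → ℝ)
    (p : EuclideanSpace ℝ (Fin n) × EuclideanSpace ℝ (Fin q)) : EuclideanSpace ℝ (Fin n) :=
  μ + α p.2 • p.1 + β p.2 • δ

variable {μ δ : EuclideanSpace ℝ (Fin n)} {α β : EuclideanSpace ℝ (Fin q) → ℝ}
  {H : Measure (EuclideanSpace ℝ (Fin q))} [IsProbabilityMeasure H]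
  {Q : Measure (EuclideanSpace ℝ (Fin n))} {S : Matrix (Fin n) (Fin n) ℝ} {ψ : ℝ → ℝ}

theorem measurable_lseMap (hα : Measurable α) (hβ : Measurable β) :
    Measurable (lseMap μ δ α β) := by
  unfold lseMap
  fun_prop

theorem lseMap_apply (p : EuclideanSpace ℝ (Fin n) × EuclideanSpace ℝ (Fin q)) (i : Fin n) :
    lseMap μ δ α β p i = μ i + β p.2 * δ i + α p.2 * p.1 i := by
  simp [lseMap]
  ring

/-- For fixed `z` the integrand is again componentwise convex in `x`, so the elliptical comparison
applies under the outer integral given by Tonelli. -/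
theorem lintegral_lseMap_le (hα : Measurable α) (hβ : Measurable β)
    (hS : S.PosDef) (hQ : IsElliptical Q 0 S ψ)
    {Q' : Measure (EuclideanSpace ℝ (Fin n))} {S' : Matrix (Fin n) (Fin n) ℝ}
    (hS' : S'.PosDef) (hQ' : IsElliptical Q' 0 S' ψ)
    (hdiag : ∀ i, S i i ≤ S' i i) (hoff : ∀ i j, i < j → S i j = S' i j)
    {f : EuclideanSpace ℝ (Fin n) → ℝ} (hf : ComponentwiseConvex f) (hf0 : ∀ x, 0 ≤ f x) :
    ∫⁻ x, ENNReal.ofReal (f x) ∂((Q.prod H).map (lseMap μ δ α β)) ≤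
      ∫⁻ x, ENNReal.ofReal (f x) ∂((Q'.prod H).map (lseMap μ δ α β)) := by
  have := hQ.isProbabilityMeasure
  have := hQ'.isProbabilityMeasure
  have hm := measurable_lseMap (μ := μ) (δ := δ) hα hβ
  have hmf := hf.measurable.ennreal_ofReal
  have hmc : Measurable fun p => ENNReal.ofReal (f (lseMap μ δ α β p)) := hmf.comp hm
  rw [lintegral_map hmf hm, lintegral_map hmf hm, lintegral_prod_symm _ hmc.aemeasurable,
    lintegral_prod_symm _ hmc.aemeasurable]
  refine lintegral_mono fun z => ?_
  have := hQ.lintegral_le hS hQ' hS' hdiag hoff (hf.comp_add_smul (μ + β z • δ) (α z))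
    fun x => hf0 _
  simpa only [lseMap, add_right_comm] using this

theorem quadForm_nonneg (hS : S.PosDef) (t : EuclideanSpace ℝ (Fin n)) : 0 ≤ quadForm S t := by
  simpa [quadForm] using hS.posSemidef.dotProduct_mulVec_nonneg t.ofLp

theorem IsElliptical.map_neg (hQ : IsElliptical Q 0 S ψ) : Q.map (fun x => -x) = Q :=
  (hQ.map_zero (S' := S) (L := fun x => -x) (A := fun t => -t) measurable_neg (fun x t => by simp)
    fun t => by simp [quadForm, Matrix.mulVec_neg]).unique hQ fun _ => rfl

theorem IsElliptical.integral_apply_eq_zero (hQ : IsElliptical Q 0 S ψ) (i : Fin n) :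
    ∫ x, x i ∂Q = 0 := by
  have hm : AEStronglyMeasurable (fun x : EuclideanSpace ℝ (Fin n) => x i)
      (Q.map fun x => -x) := (by fun_prop : Measurable _).aestronglyMeasurable
  have h := integral_map (μ := Q) measurable_neg.aemeasurable hm
  rw [hQ.map_neg] at h
  simp only [PiLp.neg_apply, integral_neg] at h
  linarith

/-- Every projection is a scaled copy of one real law `ν` determined by `ψ`; hence the second
moments for two scale matrices share the same constant. -/
theorem IsElliptical.map_inner_eq (hQ : IsElliptical Q 0 S ψ) (hS : S.PosDef)
    {ν : Measure ℝ} [IsProbabilityMeasure ν] (hν : ∀ s, charFun ν s = ((ψ (s ^ 2) : ℝ) : ℂ))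
    (t : EuclideanSpace ℝ (Fin n)) :
    Q.map (fun x => inner ℝ x t) = ν.map (fun y => Real.sqrt (quadForm S t) * y) := by
  have := hQ.isProbabilityMeasure
  have hm : Measurable fun x : EuclideanSpace ℝ (Fin n) => (inner ℝ x t : ℝ) := by fun_prop
  have hm' : Measurable fun y : ℝ => Real.sqrt (quadForm S t) * y := by fun_prop
  have := Measure.isProbabilityMeasure_map (μ := Q) hm.aemeasurable
  have := Measure.isProbabilityMeasure_map (μ := ν) hm'.aemeasurable
  refine Measure.ext_of_charFun (funext fun s => ?_)
  rw [charFun_map_of_inner_eq Q hm (t' := s • t) fun x => by simp [inner_smul_right],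
    charFun_map_of_inner_eq ν hm' (t' := s * Real.sqrt (quadForm S t)) fun x => by simp; ring,
    hQ.charFun_eq_of_zero, hν, mul_pow, Real.sq_sqrt (quadForm_nonneg hS t)]
  congr 2
  simp [quadForm, Matrix.mulVec_smul]
  ring_nf

theorem IsElliptical.integral_inner_sq (hQ : IsElliptical Q 0 S ψ) (hS : S.PosDef)
    {ν : Measure ℝ} [IsProbabilityMeasure ν] (hν : ∀ s, charFun ν s = ((ψ (s ^ 2) : ℝ) : ℂ))
    (t : EuclideanSpace ℝ (Fin n)) :
    ∫ x, (inner ℝ x t : ℝ) ^ 2 ∂Q = quadForm S t * ∫ y, y ^ 2 ∂ν := by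
  have hsq : ∀ m : Measure ℝ, AEStronglyMeasurable (fun y : ℝ => y ^ 2) m := fun m =>
    (by fun_prop : Continuous fun y : ℝ => y ^ 2).aestronglyMeasurable
  have h₁ := integral_map (μ := Q) (φ := fun x => (inner ℝ x t : ℝ))
    (by fun_prop : Measurable _).aemeasurable (hsq _)
  have h₂ := integral_map (μ := ν) (φ := fun y => Real.sqrt (quadForm S t) * y)
    (by fun_prop : Measurable _).aemeasurable (hsq _)
  rw [← h₁, hQ.map_inner_eq hS hν, h₂]
  simp_rw [mul_pow, Real.sq_sqrt (quadForm_nonneg hS t)]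
  exact integral_const_mul _ _

/-- The law of any coordinate divided by `√(S i i)` works. -/
theorem IsElliptical.exists_charFun_sq (hQ : IsElliptical Q 0 S ψ) (hS : S.PosDef) (i : Fin n) :
    ∃ ν : Measure ℝ, IsProbabilityMeasure ν ∧ ∀ s, charFun ν s = ((ψ (s ^ 2) : ℝ) : ℂ) := by
  have := hQ.isProbabilityMeasure
  have hm : Measurable fun x : EuclideanSpace ℝ (Fin n) => (Real.sqrt (S i i))⁻¹ * x i := by
    fun_prop
  refine ⟨Q.map _, Measure.isProbabilityMeasure_map hm.aemeasurable, fun s => ?_⟩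
  have hpos : 0 < S i i := hS.diag_pos
  rw [charFun_map_of_inner_eq Q hm
    (t' := EuclideanSpace.single i (s * (Real.sqrt (S i i))⁻¹)) fun x => by
      rw [EuclideanSpace.inner_single_right]
      simp
      ring,
    hQ.charFun_eq_of_zero]
  congr 2
  have hs : (Real.sqrt (S i i))⁻¹ ^ 2 * S i i = 1 := by
    rw [inv_pow, Real.sq_sqrt hpos.le, inv_mul_cancel₀ hpos.ne']
  simp only [quadForm, PiLp.ofLp_single, Matrix.mulVec_single, single_dotProduct]
  simp only [Pi.smul_apply, MulOpposite.smul_eq_mul_unop, MulOpposite.unop_op, Matrix.col_apply]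
  linear_combination s ^ 2 * hs

/-- Polarization of the second moment of projections, along `e i`, `e j` and `e i + e j`. -/
theorem IsElliptical.integral_mul_apply (hQ : IsElliptical Q 0 S ψ) (hS : S.PosDef)
    {ν : Measure ℝ} [IsProbabilityMeasure ν] (hν : ∀ s, charFun ν s = ((ψ (s ^ 2) : ℝ) : ℂ))
    (hL : ∀ i, MemLp (fun x : EuclideanSpace ℝ (Fin n) => x i) 2 Q) (i j : Fin n) :
    ∫ x, x i * x j ∂Q = S i j * ∫ y, y ^ 2 ∂ν := by
  have hi := hQ.integral_inner_sq hS hν (EuclideanSpace.single i 1)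
  have hj := hQ.integral_inner_sq hS hν (EuclideanSpace.single j 1)
  have hij := hQ.integral_inner_sq hS hν
    (EuclideanSpace.single i 1 + (1 : ℝ) • EuclideanSpace.single j 1)
  rw [quadForm_add_smul (by simpa using hS.isHermitian.eq)] at hij
  simp only [one_smul, inner_add_right, EuclideanSpace.inner_single_right, conj_trivial,
    one_mul] at hi hj hij
  have hcross : (EuclideanSpace.single i (1 : ℝ)).ofLp ⬝ᵥ
      (S *ᵥ (EuclideanSpace.single j (1 : ℝ)).ofLp) = S i j := by simp
  rw [hcross] at hij
  have hexp : ∫ x, (x i + x j) ^ 2 ∂Q =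
      ∫ x, x i ^ 2 ∂Q + 2 * ∫ x, x i * x j ∂Q + ∫ x, x j ^ 2 ∂Q := by
    have I₁ := (hL i).integrable_sq
    have I₂ := ((hL i).integrable_mul (hL j)).const_mul 2
    have I₃ := (hL j).integrable_sq
    simp only [Pi.mul_apply] at I₂
    have I₁₂ : Integrable (fun x : EuclideanSpace ℝ (Fin n) => x i ^ 2 + 2 * (x i * x j)) Q :=
      I₁.add I₂
    rw [← integral_const_mul, ← integral_add I₁ I₂, ← integral_add I₁₂ I₃]
    refine integral_congr_ae (ae_of_all _ fun x => ?_)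
    ring
  rw [hexp] at hij
  linarith

/-- A zero second moment would concentrate `Q` at the origin, which is a null set. -/
theorem IsElliptical.secondMoment_pos (hQ : IsElliptical Q 0 S ψ) (hS : S.PosDef)
    (hac : Q ≪ volume) (hL : ∀ i, MemLp (fun x : EuclideanSpace ℝ (Fin n) => x i) 2 Q)
    {ν : Measure ℝ} [IsProbabilityMeasure ν] (hν : ∀ s, charFun ν s = ((ψ (s ^ 2) : ℝ) : ℂ))
    (i : Fin n) : 0 < ∫ y, y ^ 2 ∂ν := by
  have := hQ.isProbabilityMeasure
  refine (integral_nonneg fun y => sq_nonneg y).lt_of_ne' fun h0 => ?_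
  have hz : ∀ j, ∀ᵐ x ∂Q, x j = 0 := by
    intro j
    have h := hQ.integral_mul_apply hS hν hL j j
    rw [h0, mul_zero, integral_eq_zero_iff_of_nonneg (fun x => mul_self_nonneg _)
      ((hL j).integrable_mul (hL j))] at h
    filter_upwards [h] with x hx
    simpa using hx
  have hz' : ∀ᵐ x ∂Q, x = 0 := by
    filter_upwards [ae_all_iff.2 hz] with x hx
    ext j
    simpa using hx j
  have : Nonempty (Fin n) := ⟨i⟩
  have hnz : ∀ᵐ x ∂Q, x ≠ 0 := hac.ae_le (Measure.ae_ne volume 0)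
  obtain ⟨x, hx, hx'⟩ := (hz'.and hnz).exists
  exact hx' hx

/-- Replacing `X` by `-X` preserves the joint law with `Z`; half the difference and half the sum of
the two versions isolate the scale and the location terms. -/
theorem memLp_lse_scale_and_location (hβ : Measurable β)
    (hQ : IsElliptical Q 0 S ψ) (hL : MemLp (lseMap μ δ α β) 2 (Q.prod H)) (i : Fin n) :
    MemLp (fun p : EuclideanSpace ℝ (Fin n) × EuclideanSpace ℝ (Fin q) => α p.2 * p.1 i) 2
      (Q.prod H) ∧
    MemLp (fun z => μ i + β z * δ i) 2 H := by
  have := hQ.isProbabilityMeasure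
  have hmp : MeasurePreserving (Prod.map (fun x : EuclideanSpace ℝ (Fin n) => -x) id)
      (Q.prod H) (Q.prod H) :=
    MeasurePreserving.prod ⟨measurable_neg, hQ.map_neg⟩ (MeasurePreserving.id H)
  have hi := hL.eval_piLp i
  have hi' := hi.comp_measurePreserving hmp
  constructor
  · refine ((hi.sub hi').const_smul (1 / 2 : ℝ)).ae_eq (ae_of_all _ fun p => ?_)
    simp [lseMap_apply]
    ring
  · have h : MemLp (fun p : EuclideanSpace ℝ (Fin n) × EuclideanSpace ℝ (Fin q) =>
        μ i + β p.2 * δ i) 2 (Q.prod H) := by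
      refine ((hi.add hi').const_smul (1 / 2 : ℝ)).ae_eq (ae_of_all _ fun p => ?_)
      simp [lseMap_apply]
      ring
    have hm : Measurable fun z => μ i + β z * δ i := by fun_prop
    rw [← (measurePreserving_snd (μ := Q) (ν := H)).map_eq,
      memLp_map_measure_iff hm.aestronglyMeasurable measurable_snd.aemeasurable]
    exact h

/-- By Fubini almost every slice is square integrable; one with `α z > 0` is chosen and rescaled. -/
theorem memLp_apply_of_memLp_scale [IsFiniteMeasure Q] {i : Fin n}
    (h : MemLp (fun p : EuclideanSpace ℝ (Fin n) × EuclideanSpace ℝ (Fin q) => α p.2 * p.1 i) 2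
      (Q.prod H)) (hα : 0 < H {z | 0 < α z}) :
    MemLp (fun x : EuclideanSpace ℝ (Fin n) => x i) 2 Q := by
  have hz : ∃ᵐ z ∂H, 0 < α z := frequently_ae_iff.2 hα.ne'
  obtain ⟨z, hz0, hz⟩ := (hz.and_eventually h.integrable_sq.prod_left_ae).exists
  refine (memLp_two_iff_integrable_sq
    (by fun_prop : Measurable fun x : EuclideanSpace ℝ (Fin n) => x i).aestronglyMeasurable).2 ?_
  refine (hz.const_mul ((α z)⁻¹ ^ 2)).congr (ae_of_all _ fun x => ?_)
  field_simp

theorem integrable_sq_of_memLp_scale [IsFiniteMeasure Q] {i : Fin n}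
    (h : MemLp (fun p : EuclideanSpace ℝ (Fin n) × EuclideanSpace ℝ (Fin q) => α p.2 * p.1 i) 2
      (Q.prod H)) (hQ : 0 < ∫ x, x i * x i ∂Q) : Integrable (fun z => α z ^ 2) H := by
  have hx : ∃ᵐ x ∂Q, x i ≠ 0 := by
    intro h0
    refine hQ.ne' (integral_eq_zero_of_ae ?_)
    filter_upwards [h0] with x hx
    simpa using hx
  obtain ⟨x, hx0, hx⟩ := (hx.and_eventually h.integrable_sq.prod_right_ae).exists
  refine (hx.const_mul ((x i)⁻¹ ^ 2)).congr (ae_of_all _ fun z => ?_)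
  field_simp

theorem integrable_lse_apply (hβ : Measurable β)
    (hQ : IsElliptical Q 0 S ψ) (hL : MemLp (lseMap μ δ α β) 2 (Q.prod H)) (i : Fin n) :
    Integrable (fun z => β z * δ i) H := by
  have h := (memLp_lse_scale_and_location hβ hQ hL i).2.integrable one_le_two
  exact (h.sub (integrable_const (μ i))).congr (ae_of_all _ fun z => add_sub_cancel_left _ _)

theorem integral_lse_apply (hβ : Measurable β)
    (hQ : IsElliptical Q 0 S ψ) (hL : MemLp (lseMap μ δ α β) 2 (Q.prod H)) (i : Fin n) :
    ∫ p, lseMap μ δ α β p i ∂(Q.prod H) = μ i + (∫ z, β z ∂H) * δ i := by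
  have := hQ.isProbabilityMeasure
  obtain ⟨h₁, h₂⟩ := memLp_lse_scale_and_location hβ hQ hL i
  have I₁ := h₁.integrable one_le_two
  have I₂ := (h₂.comp_measurePreserving (measurePreserving_snd (μ := Q))).integrable one_le_two
  simp only [Function.comp_def] at I₂
  simp_rw [lseMap_apply]
  rw [integral_add I₂ I₁]
  have e₁ : ∫ p : EuclideanSpace ℝ (Fin n) × EuclideanSpace ℝ (Fin q),
      α p.2 * p.1 i ∂(Q.prod H) = 0 := by
    simp_rw [mul_comm (α _)]
    rw [integral_prod_mul (fun x : EuclideanSpace ℝ (Fin n) => x i) α,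
      hQ.integral_apply_eq_zero, zero_mul]
  rw [e₁, add_zero, integral_fun_snd (fun z => μ i + β z * δ i),
    integral_add (integrable_const _) (integrable_lse_apply hβ hQ hL i), integral_mul_const]
  simp

theorem integral_lse_mul_apply (hβ : Measurable β)
    (hQ : IsElliptical Q 0 S ψ) (hL : MemLp (lseMap μ δ α β) 2 (Q.prod H)) (i j : Fin n) :
    ∫ p, lseMap μ δ α β p i * lseMap μ δ α β p j ∂(Q.prod H) =
      ∫ z, (μ i + β z * δ i) * (μ j + β z * δ j) ∂H + (∫ x, x i * x j ∂Q) * ∫ z, α z ^ 2 ∂H := by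
  have := hQ.isProbabilityMeasure
  obtain ⟨hi₁, hi₂⟩ := memLp_lse_scale_and_location hβ hQ hL i
  obtain ⟨hj₁, hj₂⟩ := memLp_lse_scale_and_location hβ hQ hL j
  replace hi₂ := hi₂.comp_measurePreserving (measurePreserving_snd (μ := Q))
  replace hj₂ := hj₂.comp_measurePreserving (measurePreserving_snd (μ := Q))
  have I₁ : Integrable (fun p : EuclideanSpace ℝ (Fin n) × EuclideanSpace ℝ (Fin q) =>
      (μ i + β p.2 * δ i) * (μ j + β p.2 * δ j)) (Q.prod H) := hi₂.integrable_mul hj₂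
  have I₂ : Integrable (fun p : EuclideanSpace ℝ (Fin n) × EuclideanSpace ℝ (Fin q) =>
      p.1 j * (α p.2 * (μ i + β p.2 * δ i))) (Q.prod H) :=
    (hi₂.integrable_mul hj₁).congr (ae_of_all _ fun p => by
      simp only [Pi.mul_apply, Function.comp]
      ring)
  have I₃ : Integrable (fun p : EuclideanSpace ℝ (Fin n) × EuclideanSpace ℝ (Fin q) =>
      p.1 i * (α p.2 * (μ j + β p.2 * δ j))) (Q.prod H) :=
    (hi₁.integrable_mul hj₂).congr (ae_of_all _ fun p => by
      simp only [Pi.mul_apply, Function.comp]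
      ring)
  have I₄ : Integrable (fun p : EuclideanSpace ℝ (Fin n) × EuclideanSpace ℝ (Fin q) =>
      p.1 i * p.1 j * α p.2 ^ 2) (Q.prod H) :=
    (hi₁.integrable_mul hj₁).congr (ae_of_all _ fun p => by
      simp only [Pi.mul_apply]
      ring)
  -- Mixed terms factor by independence and vanish because `X` is centred.
  have hcross : ∀ a b : Fin n, ∫ p : EuclideanSpace ℝ (Fin n) × EuclideanSpace ℝ (Fin q),
      p.1 a * (α p.2 * (μ b + β p.2 * δ b)) ∂(Q.prod H) = 0 := by
    intro a b
    rw [integral_prod_mul (fun x : EuclideanSpace ℝ (Fin n) => x a)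
      (fun z => α z * (μ b + β z * δ b)), hQ.integral_apply_eq_zero, zero_mul]
  have hsum := integral_add (I₁.add I₂) (I₃.add I₄)
  rw [integral_add' I₁ I₂, integral_add' I₃ I₄, hcross, hcross,
    integral_fun_snd (fun z => (μ i + β z * δ i) * (μ j + β z * δ j)),
    integral_prod_mul (fun x : EuclideanSpace ℝ (Fin n) => x i * x j) (fun z => α z ^ 2),
    probReal_univ, one_smul, add_zero, zero_add] at hsum
  rw [← hsum]
  refine integral_congr_ae (ae_of_all _ fun p => ?_)
  simp only [lseMap_apply, Pi.add_apply]
  ring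

end LSE

/-! ### Test functions and the moment relations they force. -/

section CoordinateFunctions

variable {n : ℕ}

theorem convexOn_univ_mul_add (a b : ℝ) : ConvexOn ℝ univ fun s : ℝ => a * s + b :=
  ⟨convex_univ, fun x _ y _ u v _ _ huv => by
    simp only [smul_eq_mul]
    have : b = (u + v) * b := by rw [huv, one_mul]
    nth_rewrite 1 [this]
    exact le_of_eq (by ring)⟩

theorem componentwiseConvex_const_mul_apply (c : ℝ) (i : Fin n) :
    ComponentwiseConvex fun x => c * x i := by
  intro x k
  by_cases hk : i = k
  · refine (convexOn_univ_mul_add c (c * x i)).congr fun s _ => ?_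
    simp [hk]
    ring
  · refine (convexOn_univ_mul_add 0 (c * x i)).congr fun s _ => ?_
    simp [hk]

theorem componentwiseConvex_const_mul_apply_mul_apply (c : ℝ) {i j : Fin n} (hij : i ≠ j) :
    ComponentwiseConvex fun x => c * (x i * x j) := by
  intro x k
  by_cases hi : i = k
  · have hj : j ≠ k := fun h => hij (hi.trans h.symm)
    refine (convexOn_univ_mul_add (c * x j) (c * (x i * x j))).congr fun s _ => ?_
    simp [hi, hj]
    ring
  · by_cases hj : j = k
    · refine (convexOn_univ_mul_add (c * x i) (c * (x i * x j))).congr fun s _ => ?_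
      simp [hi, hj]
      ring
    · refine (convexOn_univ_mul_add 0 (c * (x i * x j))).congr fun s _ => ?_
      simp [hi, hj]

theorem componentwiseConvex_apply_mul_self (i : Fin n) :
    ComponentwiseConvex fun x => x i * x i := by
  intro x k
  by_cases hk : i = k
  · refine ((even_two.convexOn_pow (𝕜 := ℝ)).add
      (convexOn_univ_mul_add (2 * x i) (x i * x i))).congr fun s _ => ?_
    simp [hk]
    ring
  · refine (convexOn_univ_mul_add 0 (x i * x i)).congr fun s _ => ?_
    simp [hk]

variable {Ω₁ Ω₂ : Type*} [MeasurableSpace Ω₁] [MeasurableSpace Ω₂] {P₁ : Measure Ω₁}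
  {P₂ : Measure Ω₂}
  {Y₁ : Ω₁ → EuclideanSpace ℝ (Fin n)} {Y₂ : Ω₂ → EuclideanSpace ℝ (Fin n)}

/-- A coordinate and its negative are both admissible test functions, so the inequality becomes an
equality. -/
theorem CcxLE.integral_apply_eq [IsFiniteMeasure P₁] [IsFiniteMeasure P₂]
    (h : CcxLE P₁ P₂ Y₁ Y₂) (h₁ : MemLp Y₁ 2 P₁) (h₂ : MemLp Y₂ 2 P₂) (i : Fin n) :
    ∫ ω, Y₁ ω i ∂P₁ = ∫ ω, Y₂ ω i ∂P₂ := by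
  have I₁ := (h₁.eval_piLp i).integrable one_le_two
  have I₂ := (h₂.eval_piLp i).integrable one_le_two
  have a := h _ (componentwiseConvex_const_mul_apply 1 i) (I₁.const_mul _) (I₂.const_mul _)
  have b := h _ (componentwiseConvex_const_mul_apply (-1) i) (I₁.const_mul _) (I₂.const_mul _)
  simp only [integral_const_mul] at a b
  linarith

theorem CcxLE.integral_mul_eq (h : CcxLE P₁ P₂ Y₁ Y₂) (h₁ : MemLp Y₁ 2 P₁)
    (h₂ : MemLp Y₂ 2 P₂) {i j : Fin n} (hij : i ≠ j) :
    ∫ ω, Y₁ ω i * Y₁ ω j ∂P₁ = ∫ ω, Y₂ ω i * Y₂ ω j ∂P₂ := by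
  have I₁ := (h₁.eval_piLp i).integrable_mul (h₁.eval_piLp j)
  have I₂ := (h₂.eval_piLp i).integrable_mul (h₂.eval_piLp j)
  have a := h _ (componentwiseConvex_const_mul_apply_mul_apply 1 hij) (I₁.const_mul _)
    (I₂.const_mul _)
  have b := h _ (componentwiseConvex_const_mul_apply_mul_apply (-1) hij) (I₁.const_mul _)
    (I₂.const_mul _)
  simp only [integral_const_mul] at a b
  linarith

theorem CcxLE.integral_mul_self_le (h : CcxLE P₁ P₂ Y₁ Y₂) (h₁ : MemLp Y₁ 2 P₁)
    (h₂ : MemLp Y₂ 2 P₂) (i : Fin n) :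
    ∫ ω, Y₁ ω i * Y₁ ω i ∂P₁ ≤ ∫ ω, Y₂ ω i * Y₂ ω i ∂P₂ :=
  h _ (componentwiseConvex_apply_mul_self i)
    ((h₁.eval_piLp i).integrable_mul (h₁.eval_piLp i))
    ((h₂.eval_piLp i).integrable_mul (h₂.eval_piLp i))

end CoordinateFunctions

/-! ### Transfer to the random vectors and proof of the equivalences. -/

theorem ProbabilityTheory.HasLaw.integral_comp_map {Ω E E' : Type*} [MeasurableSpace Ω]
    [MeasurableSpace E] [MeasurableSpace E'] {P : Measure Ω} {m : Measure E'} {Y : Ω → E}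
    {G : E' → E} (h : HasLaw Y (m.map G) P) (hG : Measurable G) {f : E → ℝ} (hf : Measurable f) :
    ∫ ω, f (Y ω) ∂P = ∫ p, f (G p) ∂m := by
  rw [← integral_map hG.aemeasurable hf.aestronglyMeasurable]
  exact h.integral_comp hf.aestronglyMeasurable

theorem ProbabilityTheory.HasLaw.memLp_two_lseMap {n q : ℕ} {Ω : Type*} [MeasurableSpace Ω]
    {P : Measure Ω} {Y : Ω → EuclideanSpace ℝ (Fin n)} {μ δ : EuclideanSpace ℝ (Fin n)}
    {α β : EuclideanSpace ℝ (Fin q) → ℝ} {H : Measure (EuclideanSpace ℝ (Fin q))}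
    {Q : Measure (EuclideanSpace ℝ (Fin n))}
    (h : HasLaw Y ((Q.prod H).map (lseMap μ δ α β)) P) (hα : Measurable α) (hβ : Measurable β)
    (hY : MemLp Y 2 P) : MemLp (lseMap μ δ α β) 2 (Q.prod H) := by
  have hid : AEStronglyMeasurable id ((Q.prod H).map (lseMap μ δ α β)) :=
    aestronglyMeasurable_id
  refine (memLp_map_measure_iff hid (measurable_lseMap hα hβ).aemeasurable).1 ?_
  rw [← h.map_eq] at hid ⊢
  exact (memLp_map_measure_iff hid h.aemeasurable).2 hY

section LSE

variable {n q : ℕ} {Ω₁ Ω₂ : Type*} [MeasurableSpace Ω₁] [MeasurableSpace Ω₂]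
  {P₁ : Measure Ω₁} {P₂ : Measure Ω₂}
  {Y₁ : Ω₁ → EuclideanSpace ℝ (Fin n)} {Y₂ : Ω₂ → EuclideanSpace ℝ (Fin n)}
  {μ μ₁ μ₂ δ δ₁ δ₂ : EuclideanSpace ℝ (Fin n)} {S₁ S₂ : Matrix (Fin n) (Fin n) ℝ}
  {ψ g : ℝ → ℝ} {α β : EuclideanSpace ℝ (Fin q) → ℝ}
  {H : Measure (EuclideanSpace ℝ (Fin q))} [IsProbabilityMeasure H]

theorem IsLSE.ccxLE [IsProbabilityMeasure P₁] [IsProbabilityMeasure P₂]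
    (hα : Measurable α) (hβ : Measurable β)
    (hY₁ : IsLSE P₁ Y₁ μ S₁ δ ψ g α β H) (hY₂ : IsLSE P₂ Y₂ μ S₂ δ ψ g α β H)
    (hdiag : ∀ i, S₁ i i ≤ S₂ i i) (hoff : ∀ i j, i < j → S₁ i j = S₂ i j) :
    CcxLE P₁ P₂ Y₁ Y₂ := by
  obtain ⟨hS₁, -, Q₁, hQ₁, -, hl₁⟩ := hY₁
  obtain ⟨hS₂, -, Q₂, hQ₂, -, hl₂⟩ := hY₂
  change HasLaw Y₁ ((Q₁.prod H).map (lseMap μ δ α β)) P₁ at hl₁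
  change HasLaw Y₂ ((Q₂.prod H).map (lseMap μ δ α β)) P₂ at hl₂
  intro f hf h₁ h₂
  have := Measure.isProbabilityMeasure_map (μ := P₁) hl₁.aemeasurable
  have := Measure.isProbabilityMeasure_map (μ := P₂) hl₂.aemeasurable
  rw [← integral_map hl₁.aemeasurable hf.measurable.aestronglyMeasurable,
    ← integral_map hl₂.aemeasurable hf.measurable.aestronglyMeasurable]
  refine integral_le_of_lintegral_ccx_le (fun F hF hF0 => ?_) hf
    ((integrable_map_measure hf.measurable.aestronglyMeasurable hl₁.aemeasurable).2 h₁)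
    ((integrable_map_measure hf.measurable.aestronglyMeasurable hl₂.aemeasurable).2 h₂)
  rw [hl₁.map_eq, hl₂.map_eq]
  exact lintegral_lseMap_le hα hβ hS₁ hQ₁ hS₂ hQ₂ hdiag hoff hF hF0

theorem IsLSE.mean_eq_of_ccxLE [IsProbabilityMeasure P₁] [IsProbabilityMeasure P₂]
    (hα : Measurable α) (hβ : Measurable β)
    (hY₁ : IsLSE P₁ Y₁ μ₁ S₁ δ₁ ψ g α β H) (hY₂ : IsLSE P₂ Y₂ μ₂ S₂ δ₂ ψ g α β H)
    (h₁ : MemLp Y₁ 2 P₁) (h₂ : MemLp Y₂ 2 P₂) (h : CcxLE P₁ P₂ Y₁ Y₂) (i : Fin n) :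
    μ₁ i + (∫ z, β z ∂H) * δ₁ i = μ₂ i + (∫ z, β z ∂H) * δ₂ i ∧
      Integrable (fun z => β z * δ₁ i) H ∧ Integrable (fun z => β z * δ₂ i) H := by
  obtain ⟨hS₁, -, Q₁, hQ₁, -, hl₁⟩ := hY₁
  obtain ⟨hS₂, -, Q₂, hQ₂, -, hl₂⟩ := hY₂
  change HasLaw Y₁ ((Q₁.prod H).map (lseMap μ₁ δ₁ α β)) P₁ at hl₁
  change HasLaw Y₂ ((Q₂.prod H).map (lseMap μ₂ δ₂ α β)) P₂ at hl₂
  have hL₁ := hl₁.memLp_two_lseMap hα hβ h₁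
  have hL₂ := hl₂.memLp_two_lseMap hα hβ h₂
  refine ⟨?_, integrable_lse_apply hβ hQ₁ hL₁ i, integrable_lse_apply hβ hQ₂ hL₂ i⟩
  have hm : Measurable fun x : EuclideanSpace ℝ (Fin n) => x i := by fun_prop
  rw [← integral_lse_apply hβ hQ₁ hL₁, ← integral_lse_apply hβ hQ₂ hL₂,
    ← hl₁.integral_comp_map (measurable_lseMap hα hβ) hm,
    ← hl₂.integral_comp_map (measurable_lseMap hα hβ) hm]
  exact h.integral_apply_eq h₁ h₂ i

theorem IsLSE.scale_of_ccxLE (hα : Measurable α) (hβ : Measurable β)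
    (hY₁ : IsLSE P₁ Y₁ μ S₁ δ ψ g α β H) (hY₂ : IsLSE P₂ Y₂ μ S₂ δ ψ g α β H)
    (h₁ : MemLp Y₁ 2 P₁) (h₂ : MemLp Y₂ 2 P₂) (hα0 : 0 < H {z | 0 < α z})
    (h : CcxLE P₁ P₂ Y₁ Y₂) :
    (∀ i, S₁ i i ≤ S₂ i i) ∧ ∀ i j, i < j → S₁ i j = S₂ i j := by
  obtain ⟨hS₁, -, Q₁, hQ₁, hd₁, hl₁⟩ := hY₁
  obtain ⟨hS₂, -, Q₂, hQ₂, -, hl₂⟩ := hY₂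
  change HasLaw Y₁ ((Q₁.prod H).map (lseMap μ δ α β)) P₁ at hl₁
  change HasLaw Y₂ ((Q₂.prod H).map (lseMap μ δ α β)) P₂ at hl₂
  have := hQ₁.isProbabilityMeasure
  have := hQ₂.isProbabilityMeasure
  have hL₁ := hl₁.memLp_two_lseMap hα hβ h₁
  have hL₂ := hl₂.memLp_two_lseMap hα hβ h₂
  have hac : Q₁ ≪ volume := by
    rw [hd₁]
    exact withDensity_absolutelyContinuous _ _
  have hX₁ : ∀ i, MemLp (fun x : EuclideanSpace ℝ (Fin n) => x i) 2 Q₁ := fun i =>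
    memLp_apply_of_memLp_scale (memLp_lse_scale_and_location hβ hQ₁ hL₁ i).1 hα0
  have hX₂ : ∀ i, MemLp (fun x : EuclideanSpace ℝ (Fin n) => x i) 2 Q₂ := fun i =>
    memLp_apply_of_memLp_scale (memLp_lse_scale_and_location hβ hQ₂ hL₂ i).1 hα0
  -- The location parts agree and cancel, so `κ` is the second moment of `ν` times that of `α`. The
  -- index `i₀` supplies the coordinate from which `ν` is built.
  have key : ∀ i₀ : Fin n, ∃ κ : ℝ, 0 < κ ∧ ∀ i j,
      ∫ ω, Y₂ ω i * Y₂ ω j ∂P₂ - ∫ ω, Y₁ ω i * Y₁ ω j ∂P₁ = (S₂ i j - S₁ i j) * κ := by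
    intro i₀
    obtain ⟨ν, hν, hψ⟩ := hQ₁.exists_charFun_sq hS₁ i₀
    have hpos := hQ₁.secondMoment_pos hS₁ hac hX₁ hψ i₀
    have hαI : Integrable (fun z => α z ^ 2) H := by
      refine integrable_sq_of_memLp_scale (i := i₀)
        (memLp_lse_scale_and_location hβ hQ₁ hL₁ i₀).1 ?_
      rw [hQ₁.integral_mul_apply hS₁ hψ hX₁]
      exact mul_pos hS₁.diag_pos hpos
    have hαpos : 0 < ∫ z, α z ^ 2 ∂H := by
      rw [integral_pos_iff_support_of_nonneg (fun z => sq_nonneg _) hαI]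
      refine hα0.trans_le (measure_mono fun z hz => ?_)
      have hz' : 0 < α z := hz
      exact (pow_pos hz' 2).ne'
    refine ⟨_, mul_pos hpos hαpos, fun i j => ?_⟩
    have hm : Measurable fun x : EuclideanSpace ℝ (Fin n) => x i * x j := by fun_prop
    rw [hl₁.integral_comp_map (measurable_lseMap hα hβ) hm,
      hl₂.integral_comp_map (measurable_lseMap hα hβ) hm,
      integral_lse_mul_apply hβ hQ₁ hL₁, integral_lse_mul_apply hβ hQ₂ hL₂,
      hQ₁.integral_mul_apply hS₁ hψ hX₁, hQ₂.integral_mul_apply hS₂ hψ hX₂]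
    ring
  refine ⟨fun i => ?_, fun i j hij => ?_⟩
  · obtain ⟨κ, hκ, hk⟩ := key i
    have := hk i i ▸ sub_nonneg.2 (h.integral_mul_self_le h₁ h₂ i)
    exact sub_nonneg.1 (nonneg_of_mul_nonneg_left this hκ)
  · obtain ⟨κ, hκ, hk⟩ := key i
    have := hk i j
    rw [h.integral_mul_eq h₁ h₂ hij.ne, sub_self, eq_comm, mul_eq_zero] at this
    exact (sub_eq_zero.1 (this.resolve_right hκ.ne')).symm

end LSE

theorem mainTheorem5 {n q : ℕ}
    {Ω₁ Ω₂ : Type*} [MeasurableSpace Ω₁] [MeasurableSpace Ω₂]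
    (P₁ : Measure Ω₁) [IsProbabilityMeasure P₁] (P₂ : Measure Ω₂) [IsProbabilityMeasure P₂]
    (Y₁ : Ω₁ → EuclideanSpace ℝ (Fin n)) (Y₂ : Ω₂ → EuclideanSpace ℝ (Fin n))
    (μ₁ μ₂ δ₁ δ₂ : EuclideanSpace ℝ (Fin n)) (S₁ S₂ : Matrix (Fin n) (Fin n) ℝ)
    (ψ g : ℝ → ℝ) (α β : EuclideanSpace ℝ (Fin q) → ℝ)
    (hα : Measurable α) (hβ : Measurable β) (hα0 : ∀ z, 0 ≤ α z) (hβ0 : ∀ z, 0 ≤ β z)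
    (H : Measure (EuclideanSpace ℝ (Fin q))) [IsProbabilityMeasure H]
    (hY₁ : IsLSE P₁ Y₁ μ₁ S₁ δ₁ ψ g α β H) (hY₂ : IsLSE P₂ Y₂ μ₂ S₂ δ₂ ψ g α β H) :
    (μ₁ = μ₂ → δ₁ = δ₂ → (∀ i, S₁ i i ≤ S₂ i i) → (∀ i j, i < j → S₁ i j = S₂ i j) →
      CcxLE P₁ P₂ Y₁ Y₂) ∧
    (MemLp Y₁ 2 P₁ → MemLp Y₂ 2 P₂ → 0 < H {z | 0 < α z} →
      (0 < H {z | 0 < β z} → μ₁ = μ₂ →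
        (CcxLE P₁ P₂ Y₁ Y₂ ↔
          δ₁ = δ₂ ∧ (∀ i, S₁ i i ≤ S₂ i i) ∧ (∀ i j, i < j → S₁ i j = S₂ i j))) ∧
      (δ₁ = δ₂ →
        (CcxLE P₁ P₂ Y₁ Y₂ ↔
          μ₁ = μ₂ ∧ (∀ i, S₁ i i ≤ S₂ i i) ∧ (∀ i j, i < j → S₁ i j = S₂ i j)))) := by
  refine ⟨?_, fun h₁ h₂ hαH => ⟨fun hβH hμ => ⟨fun h => ?_, ?_⟩, fun hδ => ⟨fun h => ?_, ?_⟩⟩⟩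
  · rintro rfl rfl hdiag hoff
    exact hY₁.ccxLE hα hβ hY₂ hdiag hoff
  · subst hμ
    have hδ : δ₁ = δ₂ := by
      ext i
      obtain ⟨hm, I₁, I₂⟩ := hY₁.mean_eq_of_ccxLE hα hβ hY₂ h₁ h₂ h i
      -- Finite second moments control only `β z * δ i`; if `β` is not integrable, both `i`-th
      -- entries must be zero.
      by_cases hβI : Integrable β H
      · have hβpos : 0 < ∫ z, β z ∂H := by
          rw [integral_pos_iff_support_of_nonneg hβ0 hβI]
          exact hβH.trans_le (measure_mono fun z (hz : 0 < β z) => hz.ne')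
        exact mul_left_cancel₀ hβpos.ne' (add_left_cancel hm)
      · have hzero : ∀ d : ℝ, Integrable (fun z => β z * d) H → d = 0 := fun d hd => by
          by_contra hd0
          exact hβI ((integrable_mul_const_iff (IsUnit.mk0 d hd0) β).1 hd)
        rw [hzero _ I₁, hzero _ I₂]
    subst hδ
    exact ⟨rfl, hY₁.scale_of_ccxLE hα hβ hY₂ h₁ h₂ hαH h⟩
  · subst hμ
    rintro ⟨rfl, hdiag, hoff⟩
    exact hY₁.ccxLE hα hβ hY₂ hdiag hoff
  · subst hδ
    have hμ : μ₁ = μ₂ := by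
      ext i
      -- The `β` term is the same on both sides, so it cancels whether or not `β` is integrable.
      exact add_right_cancel (hY₁.mean_eq_of_ccxLE hα hβ hY₂ h₁ h₂ h i).1
    subst hμ
    exact ⟨rfl, hY₁.scale_of_ccxLE hα hβ hY₂ h₁ h₂ hαH h⟩
  · subst hδ
    rintro ⟨rfl, hdiag, hoff⟩
    exact hY₁.ccxLE hα hβ hY₂ hdiag hoff
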